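/- For a finite group $G$ and an element $F=\sum_{g\in G}a_g g$ of the integral group ring $\mathbb Z[G]$ let $$M_G(F)=\det\left(a_{gh^{-1}}\right)_{g,h\in G}$$ be its group determinant, and define the Lind–Lehmer constant $$\lambda(G)=\frac{1}{|G|}\log\min\{|M_G(F)| : F\in\mathbb Z[G],\ |M_G(F)|\ge 2\}.$$ Let $p\ge 3$ be a prime and let $H_p$ be the Heisenberg group over $\mathbb Z_p=\mathbb Z/p\mathbb Z$, that is, the group of matrices $$\begin{pmatrix}1&a&c\\0&1&b\\0&0&1\end{pmatrix},\qquad a,b,c\in\mathbb Z_p,$$ under matrix multiplication. Then $$\lambda(H_p)=\lambda(\mathbb Z_p^3)=\frac{1}{p^3}\log\min\{x\in\mathbb Z : x\ge 2,\ x^{p-1}\equiv 1 \bmod p^3\}.$$ Indeed, the smallest value $|M_G(F)|\ge 2$ is the same for $G=H_p$ and for $G=\mathbb Z_p^3$, namely $\min\{x\ge 2 : x^{p-1}\equiv 1 \bmod p^3\}$. -/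

import Mathlib

/-- The group determinant of the element `F = ∑ a_g g` of the integral group ring `ℤ[G]`:
the determinant of the matrix with `(g, h)` entry `a_{g h⁻¹}`. -/
def groupDet {G : Type*} [Group G] [Fintype G] [DecidableEq G] (F : MonoidAlgebra ℤ G) : ℤ :=
  (Matrix.of fun g h : G => F.coeff (g * h⁻¹)).det

/-- The absolute values `|M_G(F)| ≥ 2` of the integer group determinants of `G`. -/
def nontrivialAbsDets (G : Type*) [Group G] [Fintype G] [DecidableEq G] : Set ℕ :=
  {n | 2 ≤ n ∧ ∃ F : MonoidAlgebra ℤ G, (groupDet F).natAbs = n}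

/-- The Lind–Lehmer constant `λ(G) = |G|⁻¹ log min {|M_G(F)| ≥ 2 : F ∈ ℤ[G]}`. -/
noncomputable def lindLehmer (G : Type*) [Group G] [Fintype G] [DecidableEq G] : ℝ :=
  1 / (Fintype.card G : ℝ) * Real.log ((sInf (nontrivialAbsDets G) : ℕ) : ℝ)

/-- The Heisenberg group over a commutative ring `R`: the upper unitriangular `3 × 3` matrices
under matrix multiplication. -/
def heisenberg (R : Type*) [CommRing R] : Subgroup (Matrix.SpecialLinearGroup (Fin 3) R) where
  carrier := {M | ∃ a b c : R, (M : Matrix (Fin 3) (Fin 3) R) = !![1, a, c; 0, 1, b; 0, 0, 1]}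
  one_mem' := ⟨0, 0, 0, by
    ext i j; fin_cases i <;> fin_cases j <;> simp⟩
  mul_mem' := by
    rintro M N ⟨a, b, c, hM⟩ ⟨a', b', c', hN⟩
    refine ⟨a + a', b + b', c + c' + a * b', ?_⟩
    rw [Matrix.SpecialLinearGroup.coe_mul, hM, hN]
    ext i j
    fin_cases i <;> fin_cases j <;> simp [Matrix.mul_apply, Fin.sum_univ_three] <;> ring
  inv_mem' := by
    rintro M ⟨a, b, c, hM⟩
    refine ⟨-a, -b, a * b - c, ?_⟩
    rw [Matrix.SpecialLinearGroup.coe_inv, hM, Matrix.adjugate_fin_three_of]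
    ext i j
    fin_cases i <;> fin_cases j <;> simp

noncomputable instance heisenbergFintype (R : Type*) [CommRing R] [Fintype R] [DecidableEq R] :
    Fintype (heisenberg R) :=
  Fintype.ofFinite _

/-! Both groups are central extensions of `W = ℤ_p²` by `ℤ_p` with a bilinear cocycle `B`, zero in
the abelian case. So a group determinant is the `ℤ[ℤ_p]`-norm of the determinant of a twisted
circulant matrix over the commutative ring `ℤ[ℤ_p]`, and all `B` can be treated together.

Lower bound: conjugation by translations groups the Leibniz terms into orbits, which shows that this
determinant is an integer `n` modulo `p ^ j`, `p ^ j = |W|` (`exists_det_twisted_eq`). Its norm `M`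
is then divisible by `p ^ p` if `p ∣ M`. Otherwise the trace of a circulant supplies one more factor
`p`, and induction on `j` gives `M ^ (p - 1) ≡ 1` modulo `p ^ 3`. Since `p ^ 3 - 1` satisfies this
congruence, multiples of `p ^ p` are never minimal.

Attainment: an element of `ℤ[W]` congruent to `c` modulo `p`, with `p ∤ c`, lifts to the extension
with the same absolute norm, whatever `B` is (`exists_natAbs_nrm_det_twisted_eq`). Starting from a
geometric sum of norm `±x`, taking `p`-th powers, lifting and correcting by a multiple of the sum of
all group elements realises every admissible `x`. -/

set_option linter.unusedSectionVars false

/-! ### Circulants, augmentation and norm on the integral group ring -/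

namespace AddMonoidAlgebra

section Circulant

variable {W : Type*} [AddCommGroup W] [Fintype W] [DecidableEq W]

theorem coeff_mul_eq_sum (F H : AddMonoidAlgebra ℤ W) (w : W) :
    (F * H).coeff w = ∑ v, F.coeff (w - v) * H.coeff v := by
  induction F using AddMonoidAlgebra.induction_linear with
  | zero => simp
  | add f g hf hg => simp [add_mul, hf, hg, Finset.sum_add_distrib]
  | single a r =>
    rw [coeff_single_mul_apply, Finset.sum_eq_single (-a + w)]
    · simp
    · intro b _ hb
      rw [coeff_single, Finsupp.single_eq_of_ne, zero_mul]
      rintro h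
      exact hb (by rw [← sub_eq_iff_eq_add'.mpr (sub_eq_iff_eq_add.mp h)]; abel)
    · simp

/-- The circulant matrix of an element of the group ring: multiplication by the element in the
standard basis. -/
def circ : AddMonoidAlgebra ℤ W →+* Matrix W W ℤ where
  toFun F := Matrix.of fun x y => F.coeff (x - y)
  map_one' := by
    ext x y
    simp [one_def, Matrix.one_apply, Finsupp.single_apply, sub_eq_zero, eq_comm]
  map_mul' F H := by
    ext x y
    rw [Matrix.mul_apply, Matrix.of_apply, coeff_mul_eq_sum,
      ← (Equiv.subRight y).sum_comp]
    simp
  map_zero' := by ext; simp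
  map_add' F H := by ext; simp

theorem circ_apply (F : AddMonoidAlgebra ℤ W) (x y : W) : circ F x y = F.coeff (x - y) := rfl

/-- The augmentation, that is, the sum of the coefficients. -/
def aug : AddMonoidAlgebra ℤ W →+* ℤ where
  toFun F := ∑ w, F.coeff w
  map_one' := by simp [one_def, Finsupp.single_apply]
  map_mul' F H := by
    simp_rw [coeff_mul_eq_sum]
    rw [Finset.sum_comm, Finset.sum_mul_sum]
    conv_rhs => rw [Finset.sum_comm]
    refine Finset.sum_congr rfl fun v _ => ?_
    exact (Equiv.subRight v).sum_comp fun w => F.coeff w * H.coeff v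
  map_zero' := by simp
  map_add' F H := by simp [Finset.sum_add_distrib]

theorem aug_apply (F : AddMonoidAlgebra ℤ W) : aug F = ∑ w, F.coeff w := rfl

theorem aug_single (w : W) (r : ℤ) : aug (single w r) = r := by
  simp [aug_apply, Finsupp.single_apply]

/-- The determinant of the circulant matrix of an element of the group ring. -/
noncomputable def nrm : AddMonoidAlgebra ℤ W →* ℤ := Matrix.detMonoidHom.comp (circ (W := W)).toMonoidHom

theorem nrm_apply (F : AddMonoidAlgebra ℤ W) : nrm F = (circ F).det := rfl

theorem nrm_intCast (n : ℤ) : nrm (n : AddMonoidAlgebra ℤ W) = n ^ Fintype.card W := by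
  rw [nrm_apply, map_intCast, ← Matrix.diagonal_intCast, Matrix.det_diagonal]
  simp

/-- The all-ones vector is an eigenvector of the circulant with eigenvalue `aug F`; apply the
adjugate. -/
theorem aug_dvd_nrm (F : AddMonoidAlgebra ℤ W) : aug F ∣ nrm F := by
  have h : (circ F).mulVec 1 = aug F • (1 : W → ℤ) := by
    ext x
    simp only [Matrix.mulVec, dotProduct, circ_apply, aug_apply, Pi.one_apply, mul_one,
      Pi.smul_apply, smul_eq_mul]
    exact (Equiv.subLeft x).sum_comp fun w => F.coeff w
  have h2 : (circ F).det • (1 : W → ℤ) = aug F • (circ F).adjugate.mulVec 1 := by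
    rw [← Matrix.mulVec_smul, ← h, Matrix.mulVec_mulVec, Matrix.adjugate_mul,
      Matrix.smul_mulVec, Matrix.one_mulVec]
  have h3 := congrFun h2 0
  simp only [Pi.smul_apply, Pi.one_apply, smul_eq_mul, mul_one] at h3
  exact ⟨_, h3⟩

variable (W) in
/-- The sum of all group elements. -/
noncomputable def sumAll : AddMonoidAlgebra ℤ W := ofCoeff (Finsupp.equivFunOnFinite.symm fun _ => 1)

theorem coeff_sumAll (w : W) : (sumAll W).coeff w = 1 := rfl

theorem aug_sumAll : aug (sumAll W) = Fintype.card W := by simp [aug_apply, coeff_sumAll]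

theorem mul_sumAll (F : AddMonoidAlgebra ℤ W) : F * sumAll W = (aug F : AddMonoidAlgebra ℤ W) * sumAll W := by
  rw [← zsmul_eq_mul]
  ext w
  rw [coeff_mul_eq_sum, coeff_smul]
  simp only [coeff_sumAll, mul_one, Finsupp.smul_apply, smul_eq_mul]
  exact (Equiv.subLeft w).sum_comp fun w => F.coeff w

/-- A rank-one perturbation of a scalar matrix, by the matrix determinant lemma over `ℚ`. The extra
factor `s` avoids the exponent `|W| - 1`. -/
theorem nrm_intCast_add_mul_sumAll (s k : ℤ) (hs : s ≠ 0) :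
    nrm ((s : AddMonoidAlgebra ℤ W) + (k : AddMonoidAlgebra ℤ W) * sumAll W) * s =
      s ^ Fintype.card W * (s + k * Fintype.card W) := by
  have hs' : (s : ℚ) ≠ 0 := by exact_mod_cast hs
  have key : ((circ ((s : AddMonoidAlgebra ℤ W) + (k : AddMonoidAlgebra ℤ W) * sumAll W)).map (Int.castRingHom ℚ)) =
      (s : ℚ) • (1 + Matrix.replicateCol Unit (fun _ : W => (k / s : ℚ)) *
        Matrix.replicateRow Unit (fun _ : W => (1 : ℚ))) := by
    rw [← zsmul_eq_mul, map_add, map_intCast, map_zsmul]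
    ext x y
    simp only [Matrix.map_apply, Matrix.add_apply, Matrix.smul_apply, circ_apply, coeff_sumAll,
      Matrix.mul_apply, Matrix.replicateCol_apply, Matrix.replicateRow_apply,
      ← Matrix.diagonal_intCast, Matrix.diagonal_apply, Matrix.one_apply]
    simp only [smul_eq_mul, mul_one, Finset.univ_unique, Finset.sum_const, Finset.card_singleton]
    split_ifs <;> simp <;> field_simp
  have h := congrArg Matrix.det key
  rw [Matrix.det_smul, Matrix.det_one_add_replicateCol_mul_replicateRow,
    ← RingHom.mapMatrix_apply, ← RingHom.map_det] at h
  rw [← @Int.cast_inj ℚ]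
  push_cast
  rw [nrm_apply]
  simp only [eq_intCast] at h
  rw [h]
  simp [dotProduct]
  field_simp

/-- Only the trivial character sees `sumAll W`, so only the factor `aug F` of the norm changes. -/
theorem nrm_add_mul_sumAll (F : AddMonoidAlgebra ℤ W) (k : ℤ) (hF : aug F ≠ 0) :
    nrm (F + (k : AddMonoidAlgebra ℤ W) * sumAll W) * aug F = nrm F * (aug F + k * Fintype.card W) := by
  have h : F * ((aug F : AddMonoidAlgebra ℤ W) + (k : AddMonoidAlgebra ℤ W) * sumAll W) =
      (aug F : AddMonoidAlgebra ℤ W) * (F + (k : AddMonoidAlgebra ℤ W) * sumAll W) := by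
    rw [mul_add, mul_left_comm, mul_sumAll]
    ring
  have h2 := congrArg nrm h
  rw [map_mul, map_mul, nrm_intCast] at h2
  have h3 := nrm_intCast_add_mul_sumAll (W := W) (aug F) k hF
  refine mul_left_cancel₀ (pow_ne_zero (Fintype.card W) hF) ?_
  calc _ = (aug F ^ Fintype.card W * nrm (F + (k : AddMonoidAlgebra ℤ W) * sumAll W)) * aug F := by ring
    _ = nrm F * (nrm ((aug F : AddMonoidAlgebra ℤ W) + (k : AddMonoidAlgebra ℤ W) * sumAll W) * aug F) := by
      rw [← h2]; ring
    _ = _ := by rw [h3]; ring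

/-- The term linear in `r` is the trace, `|W|` times the coefficient at `0`; the rest is divisible
by `r ^ 2`, hence by `r * |W|`. -/
theorem dvd_nrm_one_add_mul_sub_one (r : ℤ) (E : AddMonoidAlgebra ℤ W)
    (hr : (Fintype.card W : ℤ) ∣ r) :
    r * Fintype.card W ∣ nrm (1 + (r : AddMonoidAlgebra ℤ W) * E) - 1 := by
  rw [nrm_apply, map_add, map_one, map_mul, map_intCast, ← zsmul_eq_mul, Matrix.det_one_add_smul]
  have htr : (circ E).trace = Fintype.card W * E.coeff 0 := by
    simp [Matrix.trace, circ_apply]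
  rw [htr]
  obtain ⟨t, ht⟩ := hr
  generalize Polynomial.eval r (Matrix.det (1 + (Polynomial.X : Polynomial ℤ) •
    (circ E).map Polynomial.C)).divX.divX = q
  refine ⟨E.coeff 0 + t * q, ?_⟩
  linear_combination (r * q) * ht

/-- Modulo `p` the `p`-th power is additive and sends every group element to `1`. -/
theorem prime_dvd_pow_sub_aug {p : ℕ} [hp : Fact p.Prime] (hW : ∀ w : W, p • w = 0)
    (F : AddMonoidAlgebra ℤ W) :
    (p : AddMonoidAlgebra ℤ W) ∣ F ^ p - (aug F : AddMonoidAlgebra ℤ W) := by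
  induction F using AddMonoidAlgebra.induction_linear with
  | zero => simp [hp.out.ne_zero]
  | add f g hf hg =>
    obtain ⟨r, hr⟩ := exists_add_pow_prime_eq hp.out f g
    rw [hr]
    obtain ⟨a, ha⟩ := hf
    obtain ⟨b, hb⟩ := hg
    refine ⟨a + b + f * g * r, ?_⟩
    push_cast [map_add]
    linear_combination ha + hb
  | single w r =>
    have h : (p : ℤ) ∣ r ^ p - r := by
      rw [← ZMod.intCast_zmod_eq_zero_iff_dvd]
      push_cast
      rw [ZMod.pow_card, sub_self]
    obtain ⟨t, ht⟩ := h
    refine ⟨t, ?_⟩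
    rw [single_pow, hW, aug_single, intCast_def, intCast_def, natCast_def, single_mul_single,
      ← single_sub]
    simp [ht]

end Circulant

end AddMonoidAlgebra

/-! ### Orbit sums and translation of permutations -/

theorem AddAction.sum_mem_of_card_orbit_nsmul_mem {K Ω M : Type*} [AddGroup K] [AddAction K Ω]
    [Fintype Ω] [AddCommMonoid M] (S : AddSubmonoid M) (T : Ω → M)
    (hT : ∀ (k : K) ω, T (k +ᵥ ω) = T ω)
    (h : ∀ ω, Nat.card (AddAction.orbit K ω) • T ω ∈ S) : ∑ ω, T ω ∈ S := by
  classical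
  rw [Finset.sum_partition (AddAction.orbitRel K Ω)]
  refine S.sum_mem fun q hq => ?_
  obtain ⟨ω, -, rfl⟩ := Finset.mem_image.mp hq
  have hmem : ∀ y, (⟦y⟧ : Quotient (AddAction.orbitRel K Ω)) = ⟦ω⟧ ↔ y ∈ AddAction.orbit K ω :=
    fun y => Quotient.eq.trans AddAction.orbitRel_apply
  rw [Finset.sum_congr rfl (g := fun _ => T ω)]
  · rw [Finset.sum_const]
    convert h ω using 2
    rw [Nat.card_eq_fintype_card, ← Set.toFinset_card]
    congr 1
    ext y
    simp only [Finset.mem_filter, Finset.mem_univ, true_and, Set.mem_toFinset]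
    exact hmem y
  · intro y hy
    obtain ⟨k, rfl⟩ := (hmem y).mp (Finset.mem_filter.mp hy).2
    exact hT k ω

section Translation

variable {W : Type*} [AddCommGroup W]

/-- An additive commutative group acts on its permutations by conjugation with translations. -/
@[reducible]
def Equiv.Perm.translationAction (W : Type*) [AddCommGroup W] : AddAction W (Equiv.Perm W) where
  vadd k σ := (Equiv.subRight k).trans (σ.trans (Equiv.addRight k))
  zero_vadd σ := by
    change (Equiv.subRight 0).trans (σ.trans (Equiv.addRight 0)) = σ
    ext x
    simp
  add_vadd k l σ := by
    change (Equiv.subRight (k + l)).trans (σ.trans (Equiv.addRight (k + l))) =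
      (Equiv.subRight k).trans (((Equiv.subRight l).trans (σ.trans (Equiv.addRight l))).trans
        (Equiv.addRight k))
    ext x
    simp only [Equiv.trans_apply, Equiv.subRight_apply, Equiv.coe_addRight]
    rw [sub_sub, add_assoc, add_comm l k]

theorem Equiv.Perm.sign_translate [Fintype W] [DecidableEq W] (k : W) (σ : Equiv.Perm W) :
    Equiv.Perm.sign ((Equiv.subRight k).trans (σ.trans (Equiv.addRight k))) =
      Equiv.Perm.sign σ := by
  have h : (Equiv.subRight k).trans (σ.trans (Equiv.addRight k)) =
      Equiv.addRight k * σ * (Equiv.addRight k)⁻¹ := by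
    ext x
    simp [sub_eq_add_neg]
  rw [h, Equiv.Perm.sign_mul, Equiv.Perm.sign_mul, Equiv.Perm.sign_inv, mul_right_comm,
    Int.units_mul_self, one_mul]

theorem AddSubgroup.bijective_out_add (K : AddSubgroup W) :
    Function.Bijective fun u : (W ⧸ K) × K => u.1.out + (u.2 : W) := by
  constructor
  · rintro ⟨q, k⟩ ⟨q', k'⟩ h
    have hq : q = q' := by
      have := congrArg (QuotientAddGroup.mk (s := K)) h
      simpa [QuotientAddGroup.mk_add_of_mem] using this
    subst hq
    simpa using h
  · intro y
    refine ⟨(QuotientAddGroup.mk y, ⟨-(QuotientAddGroup.mk (s := K) y).out + y, ?_⟩), ?_⟩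
    · rw [← QuotientAddGroup.eq]
      exact QuotientAddGroup.out_eq' _
    · simp

theorem AddSubgroup.prod_eq_prod_out_pow [Fintype W] {M : Type*} [CommMonoid M]
    (K : AddSubgroup W) (g : W → M) (hg : ∀ y, ∀ k ∈ K, g (y + k) = g y) :
    ∃ m : M, ∏ y, g y = m ^ Nat.card K := by
  classical
  have := Fintype.ofFinite (W ⧸ K)
  have := Fintype.ofFinite K
  refine ⟨∏ q : W ⧸ K, g q.out, ?_⟩
  rw [← K.bijective_out_add.prod_comp g, Fintype.prod_prod_type, ← Finset.prod_pow]
  refine Finset.prod_congr rfl fun q _ => ?_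
  rw [Finset.prod_congr rfl fun (k : K) _ => hg q.out k k.2]
  simp

/-- On a coset `q + K` the sum is `|K| • B d q + B d (∑ k)`. The first term dies since `p ∣ |K|`,
the second since `k ↦ -k` negates it and `p` is odd. -/
theorem AddSubgroup.sum_bilin_eq_zero [Fintype W] {p : ℕ} [Fact p.Prime] (hp : p ≠ 2)
    (K : AddSubgroup W) (hK : p ∣ Nat.card K) (B : W →+ W →+ ZMod p) (d : W → W)
    (hd : ∀ y, ∀ k ∈ K, d (y + k) = d y) : ∑ y, B (d y) y = 0 := by
  classical
  have := Fintype.ofFinite (W ⧸ K)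
  have := Fintype.ofFinite K
  rw [← K.bijective_out_add.sum_comp fun y => B (d y) y, Fintype.sum_prod_type]
  refine Finset.sum_eq_zero fun q _ => ?_
  rw [Finset.sum_congr rfl fun (k : K) _ => by rw [hd q.out k k.2, map_add],
    Finset.sum_add_distrib]
  have h1 : ∑ _k : K, B (d q.out) q.out = 0 := by
    rw [Finset.sum_const, Finset.card_univ, ← Nat.card_eq_fintype_card, nsmul_eq_mul,
      (ZMod.natCast_eq_zero_iff _ _).mpr hK, zero_mul]
  have h2 : ∑ k : K, B (d q.out) k = 0 := by
    have h := Equiv.sum_comp (Equiv.neg K) fun k : K => B (d q.out) k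
    simp only [Equiv.neg_apply, AddSubgroup.coe_neg, map_neg, Finset.sum_neg_distrib] at h
    have h3 : (2 : ZMod p) * ∑ k : K, B (d q.out) k = 0 := by linear_combination -h
    have h4 : (2 : ZMod p) ≠ 0 := by
      intro h5
      have : ((2 : ℕ) : ZMod p) = 0 := by exact_mod_cast h5
      rw [ZMod.natCast_eq_zero_iff] at this
      exact hp ((Nat.prime_dvd_prime_iff_eq Fact.out Nat.prime_two).mp this)
    exact (mul_eq_zero.mp h3).resolve_left h4
  rw [h1, h2, add_zero]

end Translation

/-! ### Determinants of twisted circulants modulo the order of `W` -/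

namespace AddMonoidAlgebra

theorem exists_pow_card_eq_intCast_add {p : ℕ} [Fact p.Prime] {W : Type*} [AddCommGroup W]
    [Fintype W] [DecidableEq W] (hW : ∀ w : W, p • w = 0) (F : AddMonoidAlgebra ℤ W) (i : ℕ)
    (hi : i ≠ 0) :
    ∃ n : ℤ, (p : AddMonoidAlgebra ℤ W) ^ i ∣ F ^ p ^ i - (n : AddMonoidAlgebra ℤ W) := by
  obtain ⟨i, rfl⟩ := Nat.exists_eq_succ_of_ne_zero hi
  refine ⟨aug F ^ p ^ i, ?_⟩
  have := dvd_sub_pow_of_dvd_sub (prime_dvd_pow_sub_aug hW F) i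
  rwa [← pow_mul, ← pow_succ', ← Int.cast_pow] at this

section Twisted

variable {p : ℕ} [Fact p.Prime] {W : Type*} [AddCommGroup W] [Fintype W] [DecidableEq W]

/-- The matrix over `ℤ[ℤ/p]` of multiplication by an element of the group ring of the central
extension of `W` by `ℤ/p` with cocycle `B`. -/
noncomputable def twisted (B : W →+ W →+ ZMod p) (φ : W → AddMonoidAlgebra ℤ (ZMod p)) :
    Matrix W W (AddMonoidAlgebra ℤ (ZMod p)) :=
  Matrix.of fun x y => φ (x - y) * single (B (x - y) y) 1

theorem prod_twisted (B : W →+ W →+ ZMod p) (φ : W → AddMonoidAlgebra ℤ (ZMod p)) (f g : W → W) :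
    ∏ y, twisted B φ (f y) (g y) =
      (∏ y, φ (f y - g y)) * single (∑ y, B (f y - g y) (g y)) 1 := by
  simp only [twisted, Matrix.of_apply]
  rw [Finset.prod_mul_distrib, prod_single, Finset.prod_const_one]

/-- Translating by `k` changes the exponent of the central factor by `B (∑ (σ y - y)) k`, and that
sum vanishes. -/
theorem det_twisted_term_translate (B : W →+ W →+ ZMod p)
    (φ : W → AddMonoidAlgebra ℤ (ZMod p)) (σ : Equiv.Perm W) (k : W) :
    ∏ y, twisted B φ (((Equiv.subRight k).trans (σ.trans (Equiv.addRight k))) y) y =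
      ∏ y, twisted B φ (σ y) y := by
  rw [← Equiv.prod_comp (Equiv.addRight k)]
  simp only [Equiv.trans_apply, Equiv.subRight_apply, Equiv.coe_addRight, add_sub_cancel_right]
  rw [prod_twisted B φ (fun y => σ y + k) (fun y => y + k), prod_twisted B φ σ (fun y => y)]
  simp only [add_sub_add_right_eq_sub, map_add, Finset.sum_add_distrib]
  congr 2
  have h : ∑ y, B (σ y - y) k = 0 := by
    have := map_sum (B.flip k) (fun y => σ y - y) Finset.univ
    simp only [AddMonoidHom.flip_apply] at this
    rw [← this, Finset.sum_sub_distrib, Equiv.sum_comp σ fun y => y, sub_self, map_zero,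
      AddMonoidHom.zero_apply]
  rw [h, add_zero]

/-- The determinant of a twisted matrix is an integer modulo the order of the quotient. -/
theorem exists_det_twisted_eq (hp : p ≠ 2) {j : ℕ} (hj : Fintype.card W = p ^ j)
    (B : W →+ W →+ ZMod p) (φ : W → AddMonoidAlgebra ℤ (ZMod p)) :
    ∃ (n : ℤ) (E : AddMonoidAlgebra ℤ (ZMod p)),
      (twisted B φ).det = n + ((p ^ j : ℤ) : AddMonoidAlgebra ℤ (ZMod p)) * E := by
  let S : AddSubgroup (AddMonoidAlgebra ℤ (ZMod p)) :=
    { carrier := {r | ∃ (n : ℤ) (E : AddMonoidAlgebra ℤ (ZMod p)),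
        r = n + ((p ^ j : ℤ) : AddMonoidAlgebra ℤ (ZMod p)) * E}
      zero_mem' := ⟨0, 0, by simp⟩
      add_mem' := by
        rintro _ _ ⟨n, E, rfl⟩ ⟨n', E', rfl⟩
        exact ⟨n + n', E + E', by push_cast; ring⟩
      neg_mem' := by
        rintro _ ⟨n, E, rfl⟩
        exact ⟨-n, -E, by push_cast; ring⟩ }
  suffices h : (twisted B φ).det ∈ S from h
  let _ := Equiv.Perm.translationAction W
  rw [Matrix.det_apply]
  refine AddAction.sum_mem_of_card_orbit_nsmul_mem (K := W) S.toAddSubmonoid _ ?_ ?_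
  · intro k σ
    exact congrArg₂ (· • ·) (Equiv.Perm.sign_translate k σ) (det_twisted_term_translate B φ σ k)
  · intro σ
    change _ ∈ S
    suffices h : Nat.card (AddAction.orbit W σ) • ∏ y, twisted B φ (σ y) y ∈ S by
      rcases Int.units_eq_one_or (Equiv.Perm.sign σ) with h1 | h1
      · rwa [h1, one_smul]
      · rw [h1, Units.neg_smul, one_smul, smul_neg]
        exact S.neg_mem h
    set K := AddAction.stabilizer W σ with hKdef
    have hcard : Nat.card (AddAction.orbit W σ) * Nat.card K = p ^ j := by
      rw [← Nat.card_prod, Nat.card_congr (AddAction.orbitProdStabilizerEquivAddGroup W σ),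
        Nat.card_eq_fintype_card, hj]
    obtain ⟨i, -, hi⟩ := (Nat.dvd_prime_pow Fact.out).mp (Dvd.intro_left _ hcard)
    -- With trivial stabilizer the orbit has `p ^ j` elements, so its contribution is `0` modulo `p
    -- ^ j`.
    by_cases hi0 : i = 0
    · rw [hi, hi0, pow_zero, mul_one] at hcard
      exact ⟨0, ∏ y, twisted B φ (σ y) y, by rw [hcard]; simp⟩
    -- Otherwise `σ y - y` is constant on cosets of `K`: the central factor is trivial and the term
    -- is a `p ^ i`-th power, an integer modulo `p ^ i`. The orbit size `p ^ (j - i)` raises this to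
    -- modulo `p ^ j`.
    · have hd : ∀ y, ∀ k ∈ K, σ (y + k) - (y + k) = σ y - y := by
        intro y k hk
        have h : (Equiv.subRight k).trans (σ.trans (Equiv.addRight k)) = σ := hk
        have h2 := Equiv.congr_fun h (y + k)
        simp only [Equiv.trans_apply, Equiv.subRight_apply, Equiv.coe_addRight,
          add_sub_cancel_right] at h2
        rw [← h2]
        abel
      rw [prod_twisted B φ σ (fun y => y),
        K.sum_bilin_eq_zero hp (hi ▸ dvd_pow_self p hi0) B (fun y => σ y - y) hd]
      obtain ⟨m, hm⟩ := K.prod_eq_prod_out_pow (fun y => φ (σ y - y)) fun y k hk =>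
        congrArg φ (hd y k hk)
      obtain ⟨n, E, hE⟩ := exists_pow_card_eq_intCast_add (p := p) (fun w : ZMod p => by simp) m i hi0
      rw [hm, ← one_def, mul_one, hi]
      refine ⟨Nat.card (AddAction.orbit W σ) * n, E, ?_⟩
      rw [sub_eq_iff_eq_add.mp hE, nsmul_eq_mul]
      have hc : ((p : AddMonoidAlgebra ℤ (ZMod p)) ^ j) =
          Nat.card (AddAction.orbit W σ) * (p : AddMonoidAlgebra ℤ (ZMod p)) ^ i := by
        rw [hi] at hcard
        rw [← Nat.cast_pow, ← hcard, Nat.cast_mul, Nat.cast_pow]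
      push_cast
      rw [hc]
      ring

end Twisted

end AddMonoidAlgebra

/-! ### Congruences for norms -/

namespace AddMonoidAlgebra

/-- The element of the group ring with given coefficients. -/
noncomputable def ofFun {W : Type*} [Finite W] (f : W → ℤ) : AddMonoidAlgebra ℤ W :=
  ofCoeff (Finsupp.equivFunOnFinite.symm f)

theorem coeff_ofFun {W : Type*} [Finite W] (f : W → ℤ) (w : W) : (ofFun f).coeff w = f w := rfl

section Congruence

variable {p : ℕ} [Fact p.Prime]

theorem dvd_nrm_pow_sub_one_of_eq {j : ℕ} (hj : j ≠ 0) {n : ℤ}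
    {D E : AddMonoidAlgebra ℤ (ZMod p)}
    (hD : D = n + ((p ^ j : ℤ) : AddMonoidAlgebra ℤ (ZMod p)) * E)
    (hn : (p : ℤ) ^ j ∣ n ^ (p - 1) - 1) : (p : ℤ) ^ (j + 1) ∣ nrm D ^ (p - 1) - 1 := by
  obtain ⟨t, ht⟩ := hn
  obtain ⟨c, hc⟩ := sub_dvd_pow_sub_pow D (n : AddMonoidAlgebra ℤ (ZMod p)) (p - 1)
  have h : D ^ (p - 1) = 1 + ((p ^ j : ℤ) : AddMonoidAlgebra ℤ (ZMod p)) * (E * c + t) := by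
    have h1 : D - n = ((p ^ j : ℤ) : AddMonoidAlgebra ℤ (ZMod p)) * E := by rw [hD]; ring
    have h2 := congrArg (Int.cast : ℤ → AddMonoidAlgebra ℤ (ZMod p)) ht
    rw [h1] at hc
    push_cast at h2 hc ⊢
    linear_combination hc + h2
  rw [← map_pow, h, pow_succ]
  have := dvd_nrm_one_add_mul_sub_one (W := ZMod p) ((p : ℤ) ^ j)
    (E * c + (t : AddMonoidAlgebra ℤ (ZMod p)))
    (by rw [ZMod.card]; exact dvd_pow_self _ hj)
  rwa [ZMod.card] at this

theorem not_dvd_nrm_of_eq {j : ℕ} (hj : j ≠ 0) {n : ℤ} {D E : AddMonoidAlgebra ℤ (ZMod p)}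
    (hD : D = n + ((p ^ j : ℤ) : AddMonoidAlgebra ℤ (ZMod p)) * E) (hn : ¬ (p : ℤ) ∣ n) :
    ¬ (p : ℤ) ∣ nrm D := by
  have hp : p.Prime := Fact.out
  intro h
  obtain ⟨j, rfl⟩ := Nat.exists_eq_add_one_of_ne_zero hj
  have h1 : (p : ℤ) ^ 1 ∣ n ^ (p - 1) - 1 := by
    rw [pow_one, ← ZMod.intCast_zmod_eq_zero_iff_dvd]
    push_cast
    rw [ZMod.pow_card_sub_one_eq_one, sub_self]
    rwa [Ne, ZMod.intCast_zmod_eq_zero_iff_dvd]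
  have h2 := dvd_nrm_pow_sub_one_of_eq (j := 1) one_ne_zero (D := D)
    (E := ((p ^ j : ℤ) : AddMonoidAlgebra ℤ (ZMod p)) * E) (n := n)
    (by rw [hD]; push_cast; ring) h1
  have h3 : (p : ℤ) ∣ 1 := by
    have h4 : (p : ℤ) ∣ nrm D ^ (p - 1) := dvd_pow h (by have := hp.two_le; omega)
    have h5 := (dvd_pow_self (p : ℤ) two_ne_zero).trans h2
    simpa using dvd_sub h4 h5
  exact hp.one_lt.ne' (by exact_mod_cast Int.eq_one_of_dvd_one (by positivity) h3)

/-- Here `p ∣ n`, so `p` divides `D` itself, and the norm of `p` is `p ^ p`. -/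
theorem pow_dvd_nrm_of_eq {j : ℕ} (hj : j ≠ 0) {n : ℤ} {D E : AddMonoidAlgebra ℤ (ZMod p)}
    (hD : D = n + ((p ^ j : ℤ) : AddMonoidAlgebra ℤ (ZMod p)) * E) (h : (p : ℤ) ∣ nrm D) :
    (p : ℤ) ^ p ∣ nrm D := by
  obtain ⟨t, rfl⟩ := not_not.mp fun hn => not_dvd_nrm_of_eq hj hD hn h
  obtain ⟨j, rfl⟩ := Nat.exists_eq_add_one_of_ne_zero hj
  have h2 : D = ((p : ℤ) : AddMonoidAlgebra ℤ (ZMod p)) *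
      (t + ((p ^ j : ℤ) : AddMonoidAlgebra ℤ (ZMod p)) * E) := by
    rw [hD]; push_cast; ring
  rw [h2, map_mul, nrm_intCast, ZMod.card]
  exact dvd_mul_right _ _

variable {W : Type*} [AddCommGroup W] [Fintype W] [DecidableEq W]

/-- Augmentation erases the cocycle and leaves an ordinary circulant on `W`, which feeds the
induction. -/
theorem aug_det_twisted (B : W →+ W →+ ZMod p) (φ : W → AddMonoidAlgebra ℤ (ZMod p)) :
    aug (twisted B φ).det = nrm (ofFun fun v => aug (φ v)) := by
  rw [RingHom.map_det, nrm_apply]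
  congr 1
  ext x y
  simp [twisted, circ_apply, coeff_ofFun, aug_single]

theorem det_eq_nrm_det_twisted (B : W →+ W →+ ZMod p) (φ : W → AddMonoidAlgebra ℤ (ZMod p)) :
    (Matrix.of fun u v : W × ZMod p =>
      (φ (u.1 - v.1)).coeff (u.2 - v.2 - B (u.1 - v.1) v.1)).det = nrm (twisted B φ).det := by
  rw [nrm_apply, Matrix.det_det]
  congr 1
  ext u v
  simp only [Matrix.of_apply, Matrix.comp_apply, Matrix.map_apply, twisted, circ_apply,
    coeff_mul_single_apply, mul_one, sub_eq_add_neg]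

theorem nrm_prod (F : AddMonoidAlgebra ℤ (W × ZMod p)) :
    nrm F = nrm (twisted 0 fun v : W => ofFun fun z : ZMod p => F.coeff (v, z)).det := by
  rw [← det_eq_nrm_det_twisted, nrm_apply]
  congr 1
  ext u v
  simp [circ_apply, coeff_ofFun, Prod.sub_def]

theorem pow_dvd_nrm_det_twisted (hp : p ≠ 2) {j : ℕ} (hj : j ≠ 0) (hW : Fintype.card W = p ^ j)
    (B : W →+ W →+ ZMod p) (φ : W → AddMonoidAlgebra ℤ (ZMod p))
    (h : (p : ℤ) ∣ nrm (twisted B φ).det) : (p : ℤ) ^ p ∣ nrm (twisted B φ).det := by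
  obtain ⟨n, E, hD⟩ := exists_det_twisted_eq hp hW B φ
  exact pow_dvd_nrm_of_eq hj hD h

/-- Induction step: modulo `p ^ j` the integer `n` is a norm from `ℤ[W]`, where the congruence holds
by `hF`. -/
theorem dvd_nrm_det_twisted_pow_sub_one (hp : p ≠ 2) {j : ℕ} (hj : j ≠ 0)
    (hW : Fintype.card W = p ^ j)
    (hF : ∀ F : AddMonoidAlgebra ℤ W, ¬ (p : ℤ) ∣ nrm F → (p : ℤ) ^ j ∣ nrm F ^ (p - 1) - 1)
    (B : W →+ W →+ ZMod p) (φ : W → AddMonoidAlgebra ℤ (ZMod p))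
    (h : ¬ (p : ℤ) ∣ nrm (twisted B φ).det) :
    (p : ℤ) ^ (j + 1) ∣ nrm (twisted B φ).det ^ (p - 1) - 1 := by
  obtain ⟨n, E, hD⟩ := exists_det_twisted_eq hp hW B φ
  refine dvd_nrm_pow_sub_one_of_eq hj hD ?_
  have haug : aug (twisted B φ).det = n + p ^ j * aug E := by
    rw [hD, map_add, map_mul, map_intCast, map_intCast]
    simp
  have h1 : ¬ (p : ℤ) ∣ aug (twisted B φ).det := fun h2 => h (h2.trans (aug_dvd_nrm _))
  rw [aug_det_twisted] at h1 haug
  have h2 := hF _ h1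
  rw [haug] at h2
  have h3 : (p : ℤ) ^ j ∣ (n + p ^ j * aug E) ^ (p - 1) - n ^ (p - 1) :=
    (Dvd.intro (aug E) (by ring)).trans (sub_dvd_pow_sub_pow _ _ _)
  simpa using dvd_sub h2 h3

theorem dvd_nrm_zmod_pow_sub_one (F : AddMonoidAlgebra ℤ (ZMod p)) (h : ¬ (p : ℤ) ∣ nrm F) :
    (p : ℤ) ^ 1 ∣ nrm F ^ (p - 1) - 1 := by
  rw [pow_one, ← ZMod.intCast_zmod_eq_zero_iff_dvd]
  push_cast
  rw [ZMod.pow_card_sub_one_eq_one, sub_self]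
  rwa [Ne, ZMod.intCast_zmod_eq_zero_iff_dvd]

theorem dvd_nrm_zmod_prod_pow_sub_one (hp : p ≠ 2) (F : AddMonoidAlgebra ℤ (ZMod p × ZMod p))
    (h : ¬ (p : ℤ) ∣ nrm F) : (p : ℤ) ^ 2 ∣ nrm F ^ (p - 1) - 1 := by
  rw [nrm_prod] at h ⊢
  exact dvd_nrm_det_twisted_pow_sub_one hp one_ne_zero (by simp [ZMod.card])
    dvd_nrm_zmod_pow_sub_one 0 _ h

theorem dvd_nrm_det_twisted_zmod_prod_pow_sub_one (hp : p ≠ 2)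
    (B : ZMod p × ZMod p →+ ZMod p × ZMod p →+ ZMod p)
    (φ : ZMod p × ZMod p → AddMonoidAlgebra ℤ (ZMod p))
    (h : ¬ (p : ℤ) ∣ nrm (twisted B φ).det) :
    (p : ℤ) ^ 3 ∣ nrm (twisted B φ).det ^ (p - 1) - 1 :=
  dvd_nrm_det_twisted_pow_sub_one hp two_ne_zero (by simp [ZMod.card, sq])
    (dvd_nrm_zmod_prod_pow_sub_one hp) B φ h

end Congruence

end AddMonoidAlgebra

/-! ### Realising the admissible values -/

namespace AddMonoidAlgebra

section Achievability

variable {p : ℕ} [Fact p.Prime]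

variable (p) in
/-- The geometric sum `1 + z + ⋯ + z ^ (c - 1)`, where `z` is the generator of `ℤ/p`. -/
noncomputable def geom (c : ℕ) : AddMonoidAlgebra ℤ (ZMod p) :=
  ∑ i ∈ Finset.range c, single (1 : ZMod p) (1 : ℤ) ^ i

theorem aug_geom (c : ℕ) : aug (geom p c) = c := by
  simp [geom, aug_single]

theorem geom_self : geom p p = sumAll (ZMod p) := by
  ext z
  rw [coeff_sumAll, geom, coeff_sum, Finsupp.finsetSum_apply]
  simp only [single_pow, one_pow, coeff_single, nsmul_eq_mul, mul_one]
  rw [Finset.sum_eq_single z.val]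
  · simp
  · intro i hi hne
    refine Finsupp.single_eq_of_ne ?_
    rintro rfl
    exact hne (by rw [ZMod.val_natCast_of_lt (Finset.mem_range.mp hi)])
  · intro h
    exact absurd (Finset.mem_range.mpr (ZMod.val_lt z)) h

theorem geom_add (c d : ℕ) :
    geom p (c + d) = geom p c + single (1 : ZMod p) (1 : ℤ) ^ c * geom p d := by
  simp only [geom, Finset.sum_range_add, Finset.mul_sum, pow_add]

theorem geom_mul (c d : ℕ) :
    geom p (c * d) =
      geom p c * ∑ i ∈ Finset.range d, (single (1 : ZMod p) (1 : ℤ) ^ c) ^ i := by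
  induction d with
  | zero => simp [geom]
  | succ d ih =>
    rw [Nat.mul_succ, geom_add, ih, Finset.sum_range_succ, pow_mul]
    ring

theorem geom_one_add_mul (k : ℕ) :
    geom p (1 + k * p) = ((1 : ℤ) : AddMonoidAlgebra ℤ (ZMod p)) +
      ((k : ℤ) : AddMonoidAlgebra ℤ (ZMod p)) * sumAll (ZMod p) := by
  induction k with
  | zero => simp [geom, one_def]
  | succ k ih =>
    rw [Nat.succ_mul, ← add_assoc, geom_add, ih, geom_self, mul_sumAll (single (1 : ZMod p) (1 : ℤ) ^ _), map_pow,
      aug_single]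
    push_cast
    ring

/-- For `d` inverse to `c` modulo `p`, `geom p c * V` has norm `c * d`. The augmentations `c` and
`d` divide the two norms, so the cofactors are units. -/
theorem natAbs_nrm_geom {c : ℕ} (hc : ¬ p ∣ c) : (nrm (geom p c)).natAbs = c := by
  have hp : p.Prime := Fact.out
  have hc0 : c ≠ 0 := by rintro rfl; exact hc (dvd_zero p)
  obtain ⟨d, -, hd⟩ := Nat.exists_mul_mod_eq_one_of_coprime
    ((Nat.Prime.coprime_iff_not_dvd hp).mpr hc).symm hp.one_lt
  have hcd : c * d = 1 + (c * d / p) * p := by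
    rw [← hd, mul_comm _ p]; exact (Nat.mod_add_div _ _).symm
  have hd0 : d ≠ 0 := by rintro rfl; simp at hcd
  set V := ∑ i ∈ Finset.range d, (single (1 : ZMod p) (1 : ℤ) ^ c) ^ i
  have hV : aug V = d := by simp [V, aug_single]
  have h1 : nrm (geom p c) * nrm V = c * d := by
    rw [← map_mul, ← geom_mul, hcd, geom_one_add_mul]
    have := nrm_intCast_add_mul_sumAll (W := ZMod p) 1 (c * d / p : ℕ) one_ne_zero
    rw [mul_one, one_pow, one_mul, ZMod.card] at this
    rw [this]
    exact_mod_cast hcd.symm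
  obtain ⟨a, ha⟩ := aug_dvd_nrm (geom p c)
  obtain ⟨b, hb⟩ := aug_dvd_nrm V
  rw [aug_geom] at ha
  rw [hV] at hb
  have h2 : a * b = 1 := by
    have h3 : ((c : ℤ) * d) ≠ 0 := by positivity
    refine mul_left_cancel₀ h3 ?_
    rw [ha, hb] at h1
    linear_combination h1
  rw [ha, Int.natAbs_mul, Int.natAbs_of_isUnit (IsUnit.of_mul_eq_one b h2)]
  simp

variable {W : Type*} [AddCommGroup W] [Fintype W] [DecidableEq W]

theorem exists_natAbs_nrm_det_twisted_eq {c : ℕ} (hc : ¬ p ∣ c) {F E : AddMonoidAlgebra ℤ W}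
    (hF : F = c + (p : AddMonoidAlgebra ℤ W) * E) :
    ∃ φ : W → AddMonoidAlgebra ℤ (ZMod p), (∀ v, aug (φ v) = F.coeff v) ∧
      ∀ B : W →+ W →+ ZMod p, (nrm (twisted B φ).det).natAbs = (nrm F).natAbs := by
  -- Modulo `sumAll` the matrix is diagonal with entries `geom p c`, for every `B`; the `sumAll`
  -- terms adjust the augmentation to `F`.
  let φ : W → AddMonoidAlgebra ℤ (ZMod p) := fun v =>
    (if v = 0 then geom p c else 0) + (E.coeff v : AddMonoidAlgebra ℤ (ZMod p)) * sumAll (ZMod p)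
  have haug : ∀ v, aug (φ v) = F.coeff v := by
    intro v
    rw [hF, ← nsmul_eq_mul]
    simp only [φ, map_add, map_mul, map_intCast, aug_sumAll, ZMod.card, apply_ite aug, aug_geom,
      map_zero, coeff_add, Finsupp.add_apply, coeff_natCast, Finsupp.single_apply, coeff_smul,
      Finsupp.smul_apply, Int.cast_id, eq_comm (a := v)]
    simp [mul_comm]
  refine ⟨φ, haug, fun B => ?_⟩
  have hofFun : ofFun (fun v => aug (φ v)) = F := by
    ext v
    rw [coeff_ofFun, haug]
  have h1 : ∃ e : ℤ, (twisted B φ).det =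
      geom p c ^ Fintype.card W + (e : AddMonoidAlgebra ℤ (ZMod p)) * sumAll (ZMod p) := by
    let I := Ideal.span {sumAll (ZMod p)}
    have h2 : (twisted B φ).det - geom p c ^ Fintype.card W ∈ I := by
      rw [← Ideal.Quotient.eq, RingHom.map_det, map_pow]
      have h3 : (Ideal.Quotient.mk I).mapMatrix (twisted B φ) =
          Matrix.diagonal fun _ => Ideal.Quotient.mk I (geom p c) := by
        have h4 : Ideal.Quotient.mk I (sumAll (ZMod p)) = 0 :=
          Ideal.Quotient.eq_zero_iff_mem.mpr (Ideal.mem_span_singleton_self _)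
        ext x y
        rw [RingHom.mapMatrix_apply, Matrix.map_apply, Matrix.diagonal_apply]
        simp only [twisted, Matrix.of_apply, φ, map_mul, map_add, h4, mul_zero, add_zero]
        by_cases h : x = y
        · subst h
          simp [← one_def]
        · simp [h, sub_eq_zero]
      rw [h3, Matrix.det_diagonal]
      simp
    obtain ⟨r, hr⟩ := Ideal.mem_span_singleton'.mp h2
    refine ⟨aug r, ?_⟩
    rw [← mul_sumAll, hr]
    ring
  obtain ⟨e, he⟩ := h1
  have hc0 : (c : ℤ) ≠ 0 := by
    rintro h
    exact hc (by rw [Int.natCast_eq_zero.mp h]; exact dvd_zero p)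
  have h5 : aug (twisted B φ).det = c ^ Fintype.card W + e * (p : ℤ) := by
    rw [he, map_add, map_pow, aug_geom, map_mul, map_intCast, aug_sumAll, ZMod.card, Int.cast_id]
  have h6 := nrm_add_mul_sumAll (geom p c ^ Fintype.card W) e
    (by rw [map_pow, aug_geom]; exact pow_ne_zero _ hc0)
  rw [← he, map_pow aug, aug_geom, map_pow nrm, ZMod.card, ← h5, aug_det_twisted, hofFun] at h6
  have h7 := congrArg Int.natAbs h6
  rw [Int.natAbs_mul, Int.natAbs_mul, Int.natAbs_pow, Int.natAbs_pow, natAbs_nrm_geom hc,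
    Int.natAbs_natCast, mul_comm] at h7
  exact Nat.eq_of_mul_eq_mul_left (pow_pos (Nat.pos_of_ne_zero (by exact_mod_cast hc0)) _) h7

theorem exists_pow_prime_eq_natCast_add (hW : ∀ w : W, p • w = 0) {F : AddMonoidAlgebra ℤ W}
    {x : ℕ} (hx : (p : ℤ) ∣ aug F - x) :
    ∃ E, F ^ p = x + (p : AddMonoidAlgebra ℤ W) * E := by
  obtain ⟨E, hE⟩ := prime_dvd_pow_sub_aug hW F
  obtain ⟨t, ht⟩ := hx
  refine ⟨E + t, ?_⟩
  have h := congrArg (Int.cast : ℤ → AddMonoidAlgebra ℤ W) ht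
  push_cast at h
  linear_combination hE + h

theorem exists_zmod_prod_natAbs_nrm_eq {x : ℕ} (hx : ¬ p ∣ x) :
    ∃ F : AddMonoidAlgebra ℤ (ZMod p × ZMod p), aug F = x ^ p ∧ (nrm F).natAbs = x ^ p := by
  obtain ⟨E, hE⟩ := exists_pow_prime_eq_natCast_add (p := p) (fun w : ZMod p => by simp)
    (F := geom p x) (x := x) (by simp [aug_geom])
  obtain ⟨φ, hφ, hB⟩ := exists_natAbs_nrm_det_twisted_eq hx hE
  refine ⟨ofFun fun v => (φ v.1).coeff v.2, ?_, ?_⟩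
  · simp only [aug_apply, coeff_ofFun, Fintype.sum_prod_type] at hφ ⊢
    simp only [hφ]
    rw [← aug_apply, map_pow, aug_geom]
  · rw [nrm_prod]
    have h : (fun v => ofFun fun z => (ofFun fun v : ZMod p × ZMod p =>
        (φ v.1).coeff v.2).coeff (v, z)) = φ := by
      ext v z
      simp only [coeff_ofFun]
    rw [h, hB, map_pow, Int.natAbs_pow, natAbs_nrm_geom hx]

theorem exists_twisted_zmod_prod_natAbs_nrm_eq {x : ℕ} (hx : x ^ (p - 1) ≡ 1 [MOD p ^ 3]) :
    ∃ φ : ZMod p × ZMod p → AddMonoidAlgebra ℤ (ZMod p),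
      ∀ B : ZMod p × ZMod p →+ ZMod p × ZMod p →+ ZMod p,
        (nrm (twisted B φ).det).natAbs = x := by
  have hp : p.Prime := Fact.out
  have hpx : ¬ p ∣ x := by
    intro h
    have h1 : x ^ (p - 1) ≡ 1 [MOD p] := hx.of_dvd (dvd_pow_self p three_ne_zero)
    have h2 : p ∣ x ^ (p - 1) := dvd_pow h (by have := hp.two_le; omega)
    have h3 := (h1.symm.trans (Nat.modEq_zero_iff_dvd.mpr h2))
    exact hp.one_lt.ne' (Nat.dvd_one.mp (Nat.modEq_zero_iff_dvd.mp h3))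
  obtain ⟨F, hF, hF'⟩ := exists_zmod_prod_natAbs_nrm_eq hpx
  have hxx : x ^ (p * p) ≡ x [MOD p ^ 3] := by
    have h := ((hx.pow (p + 1)).mul_right x)
    rw [one_pow, one_mul, ← pow_mul, ← pow_succ] at h
    have h2 : (p - 1) * (p + 1) + 1 = p * p := by
      obtain ⟨q, rfl⟩ := Nat.exists_eq_add_of_le' hp.one_le
      simp only [Nat.add_sub_cancel]; ring
    rwa [h2] at h
  obtain ⟨k, hk⟩ := Nat.modEq_iff_dvd.mp hxx
  push_cast at hk
  have hpx' : (p : ℤ) ∣ aug F - x := by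
    rw [hF, ← ZMod.intCast_zmod_eq_zero_iff_dvd]
    push_cast
    rw [ZMod.pow_card, sub_self]
  obtain ⟨E, hE⟩ := exists_pow_prime_eq_natCast_add (p := p)
    (fun w : ZMod p × ZMod p => by ext <;> simp) hpx'
  -- Since `x - x ^ (p * p) = p ^ 3 * k` and `|W| = p ^ 2`, adding `p * k` copies of `sumAll` moves
  -- the augmentation of `F ^ p` to `x`, and its absolute norm from `x ^ (p * p)` to `x`, while
  -- keeping it `x` modulo `p`.
  have hF2 : F ^ p + ((p * k : ℤ) : AddMonoidAlgebra ℤ (ZMod p × ZMod p)) * sumAll _ =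
      (x : AddMonoidAlgebra ℤ (ZMod p × ZMod p)) + (p : AddMonoidAlgebra ℤ (ZMod p × ZMod p)) *
        (E + (k : AddMonoidAlgebra ℤ (ZMod p × ZMod p)) * sumAll _) := by
    rw [hE]; push_cast; ring
  obtain ⟨φ, -, hB⟩ := exists_natAbs_nrm_det_twisted_eq hpx hF2
  refine ⟨φ, fun B => (hB B).trans ?_⟩
  have hx0 : x ≠ 0 := by rintro rfl; exact hpx (dvd_zero p)
  have haug : aug (F ^ p) = (x : ℤ) ^ (p * p) := by rw [map_pow, hF, pow_mul]
  have h := nrm_add_mul_sumAll (F ^ p) (p * k) (by rw [haug]; positivity)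
  rw [haug, Fintype.card_prod, ZMod.card] at h
  have h2 : (x : ℤ) ^ (p * p) + p * k * (p * p : ℕ) = x := by push_cast; linear_combination -hk
  rw [h2] at h
  have h3 := congrArg Int.natAbs h
  rw [Int.natAbs_mul, Int.natAbs_mul, map_pow, Int.natAbs_pow, Int.natAbs_pow, hF',
    Int.natAbs_natCast, ← pow_mul, mul_comm] at h3
  exact Nat.eq_of_mul_eq_mul_left (by positivity) h3

end Achievability

end AddMonoidAlgebra

/-! ### Group determinants of the two central extensions -/

section CentralExtension

open AddMonoidAlgebra

variable {p : ℕ} [Fact p.Prime]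

theorem groupDet_eq_nrm_det_twisted {G W : Type*} [Group G] [Fintype G] [DecidableEq G]
    [AddCommGroup W] [Fintype W] [DecidableEq W] (B : W →+ W →+ ZMod p) (e : W × ZMod p ≃ G)
    (he : ∀ u v, e u * e v = e (u.1 + v.1, u.2 + v.2 + B u.1 v.1)) (F : MonoidAlgebra ℤ G) :
    groupDet F = nrm (twisted B fun v => ofFun fun z => F.coeff (e (v, z))).det := by
  rw [← det_eq_nrm_det_twisted, groupDet, ← Matrix.det_submatrix_equiv_self e]
  congr 1
  ext u v
  simp only [Matrix.submatrix_apply, Matrix.of_apply, coeff_ofFun]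
  congr 1
  rw [mul_inv_eq_iff_eq_mul, he]
  exact congrArg e (Prod.ext (by simp) (by dsimp only; ring))

theorem isLeast_nontrivialAbsDets (hp : 3 ≤ p) {G : Type*} [Group G] [Fintype G] [DecidableEq G]
    (B : ZMod p × ZMod p →+ ZMod p × ZMod p →+ ZMod p) (e : (ZMod p × ZMod p) × ZMod p ≃ G)
    (he : ∀ u v, e u * e v = e (u.1 + v.1, u.2 + v.2 + B u.1 v.1)) {m : ℕ}
    (hm : IsLeast {x : ℕ | 2 ≤ x ∧ x ^ (p - 1) ≡ 1 [MOD p ^ 3]} m) (hmp : m ≤ p ^ 3) :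
    IsLeast (nontrivialAbsDets G) m := by
  have hp2 : p ≠ 2 := by omega
  constructor
  · refine ⟨hm.1.1, ?_⟩
    obtain ⟨φ, hφ⟩ := exists_twisted_zmod_prod_natAbs_nrm_eq hm.1.2
    refine ⟨.ofCoeff (Finsupp.equivFunOnFinite.symm fun g =>
      (φ (e.symm g).1).coeff (e.symm g).2), ?_⟩
    rw [groupDet_eq_nrm_det_twisted B e he, ← hφ B]
    congr 4
    ext v z
    simp [coeff_ofFun]
  · rintro n ⟨hn, F, rfl⟩
    rw [groupDet_eq_nrm_det_twisted B e he] at hn ⊢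
    set M := nrm (twisted B fun v => ofFun fun z => F.coeff (e (v, z))).det with hM
    by_cases h : (p : ℤ) ∣ M
    · have h1 : (p : ℤ) ^ p ∣ M :=
        pow_dvd_nrm_det_twisted hp2 two_ne_zero (by simp [ZMod.card, sq]) B _ h
      have h2 : ((p ^ 3 : ℕ) : ℤ) ∣ M := by
        push_cast
        exact (pow_dvd_pow _ hp).trans h1
      exact hmp.trans (Nat.le_of_dvd (by omega) (Int.natCast_dvd.mp h2))
    · refine hm.2 ⟨hn, ?_⟩
      have h1 := dvd_nrm_det_twisted_zmod_prod_pow_sub_one hp2 B _ h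
      rw [← hM] at h1
      -- An even exponent makes the sign of `M` irrelevant.
      have heven : Even (p - 1) := (Fact.out : p.Prime).even_sub_one hp2
      refine (Nat.modEq_iff_dvd.mpr ?_).symm
      push_cast
      rwa [heven.pow_abs]

/-- The cocycle of the Heisenberg group. -/
def heisenbergCocycle (p : ℕ) : ZMod p × ZMod p →+ ZMod p × ZMod p →+ ZMod p :=
  AddMonoidHom.mk' (fun u => AddMonoidHom.mk' (fun v => u.1 * v.2) fun _ _ => mul_add _ _ _)
    fun _ _ => AddMonoidHom.ext fun _ => add_mul _ _ _

/-- Coordinates on the Heisenberg group. -/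
def heisenbergEquiv (R : Type*) [CommRing R] : (R × R) × R ≃ heisenberg R where
  toFun u := ⟨⟨!![1, u.1.1, u.2; 0, 1, u.1.2; 0, 0, 1], by simp [Matrix.det_fin_three]⟩,
    u.1.1, u.1.2, u.2, rfl⟩
  invFun M := ((M.1.1 0 1, M.1.1 1 2), M.1.1 0 2)
  left_inv u := by simp
  right_inv := by
    rintro ⟨M, a, b, c, h⟩
    apply Subtype.ext
    apply Subtype.ext
    simp [h]

theorem heisenbergEquiv_mul {R : Type*} [CommRing R] (u v : (R × R) × R) :
    heisenbergEquiv R u * heisenbergEquiv R v =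
      heisenbergEquiv R (u.1 + v.1, u.2 + v.2 + u.1.1 * v.1.2) := by
  apply Subtype.ext
  apply Subtype.ext
  rw [Subgroup.coe_mul, Matrix.SpecialLinearGroup.coe_mul]
  simp only [heisenbergEquiv, Equiv.coe_fn_mk]
  ext i j
  fin_cases i <;> fin_cases j <;>
    simp [Matrix.mul_apply, Fin.sum_univ_three] <;> ring

/-- Coordinates on the elementary abelian group of rank three. -/
def prodEquivMultiplicativeFinThree (R : Type*) : (R × R) × R ≃ Multiplicative (Fin 3 → R) where
  toFun u := Multiplicative.ofAdd ![u.1.1, u.1.2, u.2]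
  invFun f := ((f.toAdd 0, f.toAdd 1), f.toAdd 2)
  left_inv u := by simp
  right_inv f := by
    apply Multiplicative.toAdd.injective
    ext i
    fin_cases i <;> rfl

theorem prodEquivMultiplicativeFinThree_mul {R : Type*} [AddCommGroup R] (u v : (R × R) × R) :
    prodEquivMultiplicativeFinThree R u * prodEquivMultiplicativeFinThree R v =
      prodEquivMultiplicativeFinThree R (u.1 + v.1, u.2 + v.2) := by
  apply Multiplicative.toAdd.injective
  ext i
  fin_cases i <;> rfl

end CentralExtension

/-! ### The minimum and the Lind–Lehmer constants -/

theorem sub_one_pow_modEq_one {p : ℕ} (hp : p.Prime) (hp3 : 3 ≤ p) :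
    (p ^ 3 - 1) ^ (p - 1) ≡ 1 [MOD p ^ 3] := by
  have heven : Even (p - 1) := hp.even_sub_one (by omega)
  refine (Nat.modEq_iff_dvd.mpr ?_).symm
  have h1 : 1 ≤ p ^ 3 := Nat.one_le_pow _ _ hp.pos
  push_cast [Nat.cast_sub h1]
  have h := sub_dvd_pow_sub_pow ((p : ℤ) ^ 3 - 1) (-1) (p - 1)
  rw [heven.neg_one_pow] at h
  simpa using h

theorem mainTheorem7 (p : ℕ) [Fact p.Prime] (hp : 3 ≤ p) :
    lindLehmer (heisenberg (ZMod p)) = lindLehmer (Multiplicative (Fin 3 → ZMod p)) ∧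
    ∃ m : ℕ,
      IsLeast {x : ℕ | 2 ≤ x ∧ x ^ (p - 1) ≡ 1 [MOD p ^ 3]} m ∧
      lindLehmer (Multiplicative (Fin 3 → ZMod p)) = 1 / (p : ℝ) ^ 3 * Real.log (m : ℝ) ∧
      IsLeast (nontrivialAbsDets (heisenberg (ZMod p))) m ∧
      IsLeast (nontrivialAbsDets (Multiplicative (Fin 3 → ZMod p))) m := by
  have hp3 : 3 ^ 3 ≤ p ^ 3 := Nat.pow_le_pow_left hp 3
  have hmem : p ^ 3 - 1 ∈ {x : ℕ | 2 ≤ x ∧ x ^ (p - 1) ≡ 1 [MOD p ^ 3]} :=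
    ⟨by omega, sub_one_pow_modEq_one Fact.out hp⟩
  have hm : IsLeast _ _ := ⟨Nat.sInf_mem ⟨_, hmem⟩, fun x hx => Nat.sInf_le hx⟩
  have hmp := (hm.2 hmem).trans (Nat.sub_le _ _)
  have hH := isLeast_nontrivialAbsDets hp (heisenbergCocycle p) (heisenbergEquiv (ZMod p))
    heisenbergEquiv_mul hm hmp
  have hA := isLeast_nontrivialAbsDets hp 0 (prodEquivMultiplicativeFinThree (ZMod p))
    (fun u v => by simpa using prodEquivMultiplicativeFinThree_mul u v) hm hmp
  have hcardH : Fintype.card (heisenberg (ZMod p)) = p ^ 3 := by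
    rw [← Fintype.card_congr (heisenbergEquiv (ZMod p))]
    simp only [Fintype.card_prod, ZMod.card]
    ring
  have hcardA : Fintype.card (Multiplicative (Fin 3 → ZMod p)) = p ^ 3 := by
    rw [← Fintype.card_congr (prodEquivMultiplicativeFinThree (ZMod p))]
    simp only [Fintype.card_prod, ZMod.card]
    ring
  refine ⟨?_, _, hm, ?_, hH, hA⟩
  · rw [lindLehmer, lindLehmer, hH.csInf_eq, hA.csInf_eq, hcardH, hcardA]
  · rw [lindLehmer, hA.csInf_eq, hcardA, Nat.cast_pow]
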